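/- Call a family $\mathcal U$ of open subsets of a topological space $X$ an open cover of $X$ if $\bigcup\mathcal U=X$, and let $\mathcal O$ be the collection of all open covers of $X$ (when $X$ is empty, only nonempty families are counted). Let $\Gamma$ be the collection of all open $\gamma$-covers of $X$, that is, infinite families of open sets such that each $x\in X$ belongs to all but finitely many members of the family. - $X$ satisfies $\mathsf S_1(\mathcal O,\mathcal O)$ if for each sequence $(\mathcal U_n)_{n\in\mathbb N}$ of open covers of $X$ there are $U_n\in\mathcal U_n$ ($n\in\mathbb N$) such that $\{U_n:n\in\mathbb N\}$ is an open cover of $X$. - $X$ satisfies $\mathsf U_{fin}(\mathcal O,\Gamma)$ if for each sequence $(\mathcal U_n)_{n\in\mathbb N}$ of open covers of $X$, none of which contains a finite subcover, there are finite (possibly empty) sets $\mathcal F_n\subseteq\mathcal U_n$ ($n\in\mathbb N$) such that $\{\bigcup\mathcal F_n:n\in\mathbb N\}$ is an open $\gamma$-cover of $X$. A set $X\subseteq\mathbb R$, with the subspace topology, has the Gerlits–Nagy covering property $(*)_{GN}$ if it satisfies both $\mathsf S_1(\mathcal O,\mathcal O)$ and $\mathsf U_{fin}(\mathcal O,\Gamma)$.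 A set $X\subseteq\mathbb R$ has strong measure zero ($SMZ$) if for each sequence $(\varepsilon_n)_{n\in\mathbb N}$ of positive reals there are sets $A_n\subseteq\mathbb R$ with $\operatorname{diam}A_n<\varepsilon_n$ for all $n$ and $X\subseteq\bigcup_n A_n$. For a property $P$ of sets of reals, let $BC(P)$ (the Borel Conjecture for sets with property $P$) be the assertion that every set of reals with property $P$ is countable. **Theorem.** $BC((*)_{GN})\Leftrightarrow BC(SMZ)$. That is, every $(*)_{GN}$ set of reals is countable if and only if every strong measure zero set of reals is countable. -/

import Mathlib

open Set

namespace BorelConj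

/-- The collection `O` of all (nonempty) open covers of the space `X`.
Nonemptiness of the family is automatic unless `X` is empty. -/
def openCovers (X : Type*) [TopologicalSpace X] : Set (Set (Set X)) :=
  {𝒰 | 𝒰.Nonempty ∧ (∀ U ∈ 𝒰, IsOpen U) ∧ ⋃₀ 𝒰 = univ}

/-- The collection `Γ` of all open `γ`-covers of `X`: infinite families of open sets such that
each point of `X` belongs to all but finitely many members of the family. -/
def gammaCovers (X : Type*) [TopologicalSpace X] : Set (Set (Set X)) :=
  {𝒰 | 𝒰.Infinite ∧ (∀ U ∈ 𝒰, IsOpen U) ∧ ∀ x : X, {U ∈ 𝒰 | x ∉ U}.Finite}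

/-- The selection principle `S₁(𝔄, 𝔅)`: from each sequence of members of `𝔄` one can pick one
element of each, such that the picked elements form a member of `𝔅`. -/
def S1 {X : Type*} (𝔄 𝔅 : Set (Set (Set X))) : Prop :=
  ∀ 𝒰 : ℕ → Set (Set X), (∀ n, 𝒰 n ∈ 𝔄) →
    ∃ V : ℕ → Set X, (∀ n, V n ∈ 𝒰 n) ∧ range V ∈ 𝔅

/-- The selection principle `U_fin(𝔄, 𝔅)`: for each sequence of members of `𝔄`, none of which
contains a finite subcover of `X`, one can pick a finite (possibly empty) subset `ℱ n` of the
`n`-th one, such that the unions `⋃ ℱ n` form a member of `𝔅`. -/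
def Ufin {X : Type*} (𝔄 𝔅 : Set (Set (Set X))) : Prop :=
  ∀ 𝒰 : ℕ → Set (Set X), (∀ n, 𝒰 n ∈ 𝔄) →
    (∀ n, ∀ ℱ ⊆ 𝒰 n, ℱ.Finite → ⋃₀ ℱ ≠ univ) →
    ∃ ℱ : ℕ → Set (Set X), (∀ n, ℱ n ⊆ 𝒰 n ∧ (ℱ n).Finite) ∧ range (fun n => ⋃₀ ℱ n) ∈ 𝔅

/-- The Gerlits–Nagy covering property `(*)_GN` of a set of reals (with the subspace topology):
`S₁(O, O)` (the Rothberger property) together with `U_fin(O, Γ)` (the Hurewicz property). -/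
def GerlitsNagy (X : Set ℝ) : Prop :=
  S1 (openCovers X) (openCovers X) ∧ Ufin (openCovers X) (gammaCovers X)

/-- A set of reals has strong measure zero if for each sequence of positive reals `ε n` it can be
covered by sets `A n` of diameter smaller than `ε n`. -/
def StrongMeasureZero (X : Set ℝ) : Prop :=
  ∀ ε : ℕ → ℝ, (∀ n, 0 < ε n) →
    ∃ A : ℕ → Set ℝ, (∀ n, Metric.ediam (A n) < ENNReal.ofReal (ε n)) ∧ X ⊆ ⋃ n, A n

/-- The Borel Conjecture for sets with property `P`: the hypothesis that every set of reals with
property `P` is countable. -/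
def BC (P : Set ℝ → Prop) : Prop :=
  ∀ X : Set ℝ, P X → X.Countable

end BorelConj

/-! Rothberger spaces have strong measure zero: apply `S1` to the covers by open sets of small
diameter. This settles one direction. Conversely, an uncountable strong measure zero set `X` yields
an uncountable Gerlits–Nagy set, by a dichotomy on families of `ℵ₁` functions in `ℕ → ℕ`. If all of
them are `≤*`-bounded, take a subset of `X` of size `ℵ₁`. It still has strong measure zero, and
boundedness of its images supplies both selection principles. If one is unbounded, refine it to an
unbounded `<*`-increasing family of length `ω₁`. The ranges of its members, together with the finite
subsets of `ℕ`, form an uncountable set in the Cantor space. A fast-growing function leaves gaps in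
its range, so its code looks locally like a finite set; hence open covers of the finite sets catch
all but countably many points, even in the Hurewicz sense. -/

open Filter Cardinal

namespace BorelConj

/-! ### Criteria for the selection principles -/

section SelectionPrinciples

variable {X : Type*} [TopologicalSpace X]

/-- The Hurewicz property for countable covers gives `U_fin(O, Γ)`. -/
theorem ufin_of_countable_covers [SecondCountableTopology X]
    (H : ∀ U : ℕ → ℕ → Set X, (∀ n k, IsOpen (U n k)) → (∀ n x, ∃ k, x ∈ U n k) →
      ∃ h : ℕ → ℕ, ∀ x, ∀ᶠ n in atTop, ∃ k ≤ h n, x ∈ U n k) :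
    Ufin (openCovers X) (gammaCovers X) := by
  intro 𝒰 h𝒰 hfin
  have hu : ∀ n, ∃ u : ℕ → Set X, (∀ k, u k ∈ 𝒰 n) ∧ ∀ x, ∃ k, x ∈ u k := by
    intro n
    obtain ⟨T, hTc, hTs, hT⟩ := TopologicalSpace.isOpen_sUnion_countable (𝒰 n) (h𝒰 n).2.1
    rw [(h𝒰 n).2.2] at hT
    have hne : T.Nonempty := by
      by_contra h
      rw [not_nonempty_iff_eq_empty] at h
      subst h
      exact hfin n ∅ (empty_subset _) finite_empty hT
    obtain ⟨u, rfl⟩ := hTc.exists_eq_range hne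
    refine ⟨u, fun k => hTs ⟨k, rfl⟩, fun x => ?_⟩
    have hx : x ∈ ⋃₀ range u := hT ▸ mem_univ x
    simpa using hx
  choose u hu𝒰 hux using hu
  obtain ⟨h, hh⟩ := H u (fun n k => (h𝒰 n).2.1 _ (hu𝒰 n k)) hux
  have hsub : ∀ n, u n '' Iic (h n) ⊆ 𝒰 n := by
    rintro n _ ⟨k, -, rfl⟩
    exact hu𝒰 n k
  have hev : ∀ x, ∀ᶠ n in atTop, x ∈ ⋃₀ (u n '' Iic (h n)) := by
    intro x
    filter_upwards [hh x] with n hn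
    obtain ⟨k, hk, hxk⟩ := hn
    exact ⟨_, ⟨k, hk, rfl⟩, hxk⟩
  refine ⟨fun n => u n '' Iic (h n), fun n => ⟨hsub n, (finite_Iic _).image _⟩, ?_, ?_, ?_⟩
  · intro hF
    have hx : ∀ n, ∃ x, x ∉ ⋃₀ (u n '' Iic (h n)) := fun n =>
      (ne_univ_iff_exists_notMem _).1 (hfin n _ (hsub n) ((finite_Iic _).image _))
    have hx' : ∀ V ∈ range (fun n => ⋃₀ (u n '' Iic (h n))), ∃ x, x ∉ V := by
      rintro _ ⟨n, rfl⟩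
      exact hx n
    have : Nonempty X := ⟨(hx 0).choose⟩
    -- Were there finitely many unions, one `n` would be late enough for the `n`-th union to contain
    -- every chosen point `p V`, including the one it misses.
    choose! p hp using hx'
    obtain ⟨n, hn⟩ := ((eventually_all_finite hF).2 fun V _ => hev (p V)).exists
    exact hp _ ⟨n, rfl⟩ (hn _ ⟨n, rfl⟩)
  · rintro _ ⟨n, rfl⟩
    exact isOpen_sUnion fun V hV => (h𝒰 n).2.1 V (hsub n hV)
  · intro x
    have hx := hev x
    rw [← Nat.cofinite_eq_atTop, eventually_cofinite] at hx
    refine (hx.image fun n => ⋃₀ (u n '' Iic (h n))).subset ?_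
    rintro _ ⟨⟨n, rfl⟩, hn⟩
    exact ⟨n, hn, rfl⟩

theorem exists_selection_covering_countable {C : Set X} (hC : C.Countable)
    {𝒰 : ℕ → Set (Set X)} (h𝒰 : ∀ n, 𝒰 n ∈ openCovers X) :
    ∃ V : ℕ → Set X, (∀ n, V n ∈ 𝒰 n) ∧ C ⊆ ⋃ n, V n := by
  rcases C.eq_empty_or_nonempty with rfl | hne
  · choose V hV using fun n => (h𝒰 n).1
    exact ⟨V, hV, empty_subset _⟩
  · obtain ⟨c, rfl⟩ := hC.exists_eq_range hne
    have : ∀ n, ∃ U ∈ 𝒰 n, c n ∈ U := fun n => by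
      have : c n ∈ ⋃₀ 𝒰 n := (h𝒰 n).2.2 ▸ mem_univ _
      simpa using this
    choose V hV hc using this
    refine ⟨V, hV, ?_⟩
    rintro _ ⟨n, rfl⟩
    exact mem_iUnion.2 ⟨n, hc n⟩

/-- A space concentrated on a countable set satisfies `S₁(O, O)`. -/
theorem s1_of_concentrated {D : Set X} (hD : D.Countable)
    (hconc : ∀ U : Set X, IsOpen U → D ⊆ U → Uᶜ.Countable) :
    S1 (openCovers X) (openCovers X) := by
  intro 𝒰 h𝒰
  obtain ⟨V, hV, hDV⟩ := exists_selection_covering_countable hD fun n => h𝒰 (2 * n)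
  obtain ⟨W, hW, hCW⟩ := exists_selection_covering_countable
    (hconc _ (isOpen_iUnion fun n => (h𝒰 _).2.1 _ (hV n)) hDV) fun n => h𝒰 (2 * n + 1)
  have hS : ∀ n, (if Even n then V (n / 2) else W (n / 2)) ∈ 𝒰 n := by
    intro n
    split_ifs with h
    · have := hV (n / 2)
      rwa [Nat.two_mul_div_two_of_even h] at this
    · have := hW (n / 2)
      rwa [Nat.two_mul_div_two_add_one_of_odd (Nat.not_even_iff_odd.1 h)] at this
  refine ⟨_, hS, range_nonempty _, ?_, ?_⟩
  · rintro _ ⟨n, rfl⟩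
    exact (h𝒰 n).2.1 _ (hS n)
  · refine eq_univ_of_forall fun x => ?_
    by_cases hx : x ∈ ⋃ n, V n
    · obtain ⟨n, hn⟩ := mem_iUnion.1 hx
      exact ⟨_, ⟨2 * n, rfl⟩, by simpa using hn⟩
    · obtain ⟨n, hn⟩ := mem_iUnion.1 (hCW hx)
      refine ⟨_, ⟨2 * n + 1, rfl⟩, ?_⟩
      have h2 : (2 * n + 1) / 2 = n := by omega
      simpa [h2] using hn

end SelectionPrinciples

/-! ### Strong measure zero and bounded images -/

section StrongMeasureZero

theorem StrongMeasureZero.mono {X Y : Set ℝ} (hX : StrongMeasureZero X) (h : Y ⊆ X) :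
    StrongMeasureZero Y := fun ε hε =>
  let ⟨A, hA, hXA⟩ := hX ε hε
  ⟨A, hA, h.trans hXA⟩

theorem StrongMeasureZero.exists_cover_frequently {X : Set ℝ} (hX : StrongMeasureZero X)
    {ε : ℕ → ℝ} (hε : ∀ n, 0 < ε n) :
    ∃ A : ℕ → Set ℝ, (∀ n, Metric.ediam (A n) < ENNReal.ofReal (ε n)) ∧
      ∀ x ∈ X, ∀ N, ∃ n ≥ N, x ∈ A n := by
  -- Splitting the indices into infinitely many sequences gives a full cover for each `i`, and the
  -- `N`-th uses only indices at least `N`.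
  choose B hB hXB using fun i => hX (fun j => ε (Nat.pair i j)) fun j => hε _
  refine ⟨fun n => B n.unpair.1 n.unpair.2, fun n => ?_, fun x hx N => ?_⟩
  · simpa using hB n.unpair.1 n.unpair.2
  · obtain ⟨j, hj⟩ := mem_iUnion.1 (hXB N hx)
    exact ⟨Nat.pair N j, Nat.left_le_pair N j, by simpa using hj⟩

theorem strongMeasureZero_of_s1 {X : Set ℝ} (hX : S1 (openCovers X) (openCovers X)) :
    StrongMeasureZero X := by
  intro ε hε
  let 𝒰 : ℕ → Set (Set X) := fun n =>
    {U | IsOpen U ∧ Metric.ediam (Subtype.val '' U) < ENNReal.ofReal (ε n)}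
  have h𝒰 : ∀ n, 𝒰 n ∈ openCovers X := by
    intro n
    refine ⟨⟨∅, isOpen_empty, by simpa using hε n⟩, fun U hU => hU.1, eq_univ_of_forall fun x => ?_⟩
    refine ⟨Metric.ball x (ε n / 4), ⟨Metric.isOpen_ball, ?_⟩, Metric.mem_ball_self (by
      have := hε n
      positivity)⟩
    have hle : Metric.ediam (Subtype.val '' Metric.ball x (ε n / 4)) ≤
        ENNReal.ofReal (ε n / 2) := by
      refine Metric.ediam_le ?_
      rintro _ ⟨y, hy, rfl⟩ _ ⟨z, hz, rfl⟩
      rw [edist_dist]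
      refine ENNReal.ofReal_le_ofReal ?_
      have h1 := dist_triangle_right (y : ℝ) z x
      have h2 : dist (y : ℝ) x < ε n / 4 := hy
      have h3 : dist (z : ℝ) x < ε n / 4 := hz
      linarith
    refine hle.trans_lt ?_
    rw [ENNReal.ofReal_lt_ofReal_iff (hε n)]
    linarith [hε n]
  obtain ⟨V, hV, hcov⟩ := hX 𝒰 h𝒰
  refine ⟨fun n => Subtype.val '' V n, fun n => (hV n).2, fun x hx => ?_⟩
  have : (⟨x, hx⟩ : X) ∈ ⋃₀ range V := hcov.2.2 ▸ mem_univ _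
  obtain ⟨_, ⟨n, rfl⟩, hn⟩ := this
  exact mem_iUnion.2 ⟨n, _, hn, rfl⟩

/-- A strong measure zero set whose images in `ℕ → ℕ` are all bounded is Gerlits–Nagy. -/
theorem StrongMeasureZero.gerlitsNagy_of_bounded {X : Set ℝ} (hX : StrongMeasureZero X)
    (hb : ∀ G : X → ℕ → ℕ, ∃ g, ∀ x, G x ≤ᶠ[atTop] g) : GerlitsNagy X := by
  constructor
  · intro 𝒰 h𝒰
    have hball : ∀ (x : X) n, ∃ k : ℕ, ∃ U ∈ 𝒰 n, Metric.ball x (1 / ((k : ℝ) + 1)) ⊆ U := by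
      intro x n
      have : x ∈ ⋃₀ 𝒰 n := (h𝒰 n).2.2 ▸ mem_univ x
      obtain ⟨U, hU, hxU⟩ := this
      obtain ⟨ε, hε, hεU⟩ := Metric.isOpen_iff.1 ((h𝒰 n).2.1 U hU) x hxU
      obtain ⟨k, hk⟩ := exists_nat_one_div_lt hε
      exact ⟨k, U, hU, (Metric.ball_subset_ball hk.le).trans hεU⟩
    choose G hG using hball
    obtain ⟨g, hg⟩ := hb G
    -- Since `g` eventually bounds `G x`, for large `n` any `A n` containing `x` fits in the ball
    -- witnessing `G x n`. Covering infinitely often makes such `n` available.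
    obtain ⟨A, hA, hXA⟩ := hX.exists_cover_frequently (ε := fun n => 1 / ((g n : ℝ) + 1))
      fun n => by positivity
    have hV : ∀ n, ∃ V ∈ 𝒰 n, (∃ U ∈ 𝒰 n, Subtype.val ⁻¹' A n ⊆ U) → Subtype.val ⁻¹' A n ⊆ V := by
      intro n
      by_cases h : ∃ U ∈ 𝒰 n, Subtype.val ⁻¹' A n ⊆ U
      · obtain ⟨U, hU, hAU⟩ := h
        exact ⟨U, hU, fun _ => hAU⟩
      · obtain ⟨U, hU⟩ := (h𝒰 n).1
        exact ⟨U, hU, fun h' => absurd h' h⟩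
    choose V hV𝒰 hAV using hV
    refine ⟨V, hV𝒰, range_nonempty _, ?_, eq_univ_of_forall fun x => ?_⟩
    · rintro _ ⟨n, rfl⟩
      exact (h𝒰 n).2.1 _ (hV𝒰 n)
    obtain ⟨N, hN⟩ := eventually_atTop.1 (hg x)
    obtain ⟨n, hn, hxn⟩ := hXA x x.2 N
    refine ⟨V n, ⟨n, rfl⟩, hAV n ?_ hxn⟩
    obtain ⟨U, hU, hxU⟩ := hG x n
    refine ⟨U, hU, fun y hy => hxU ?_⟩
    have h1 : edist (y : ℝ) x < ENNReal.ofReal (1 / ((g n : ℝ) + 1)) :=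
      (Metric.edist_le_ediam_of_mem (s := A n) hy hxn).trans_lt (hA n)
    rw [edist_dist, ENNReal.ofReal_lt_ofReal_iff (by positivity)] at h1
    refine lt_of_lt_of_le (show dist y x < _ from h1) ?_
    have h2 : (G x n : ℝ) ≤ g n := by exact_mod_cast hN n hn
    exact one_div_le_one_div_of_le (by positivity) (by linarith)
  · refine ufin_of_countable_covers fun U _ hcov => ?_
    choose G hG using hcov
    obtain ⟨h, hh⟩ := hb fun x n => G n x
    exact ⟨h, fun x => (hh x).mono fun n hn => ⟨_, hn, hG n x⟩⟩

end StrongMeasureZero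

/-! ### Scales of length `ω₁` and gaps in ranges -/

section Scales

/-- A countable family in `ℕ → ℕ` is eventually strictly dominated by a strictly increasing
function. -/
theorem exists_strictMono_dominating {ι : Type*} [Countable ι] (f : ι → ℕ → ℕ) :
    ∃ h : ℕ → ℕ, StrictMono h ∧ ∀ i, ∀ᶠ n in atTop, f i n < h n := by
  obtain ⟨e, he⟩ := exists_injective_nat ι
  let F : ℕ → ℕ → ℕ := fun k => Function.extend e f (fun _ _ => 0) k
  refine ⟨fun n => ∑ l ∈ Finset.range (n + 1), (∑ k ∈ Finset.range (l + 1), F k l + 1),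
    strictMono_nat_of_lt_succ fun n => ?_, fun i => ?_⟩
  · rw [Finset.sum_range_succ _ (n + 1)]
    omega
  · filter_upwards [eventually_ge_atTop (e i)] with n hn
    have h1 : f i n = F (e i) n := by simp only [F, he.extend_apply]
    have h2 : F (e i) n ≤ ∑ k ∈ Finset.range (n + 1), F k n :=
      Finset.single_le_sum (f := fun k => F k n) (fun _ _ => Nat.zero_le _)
        (Finset.mem_range.2 (by omega))
    have h3 : (∑ k ∈ Finset.range (n + 1), F k n + 1) ≤
        ∑ l ∈ Finset.range (n + 1), (∑ k ∈ Finset.range (l + 1), F k l + 1) :=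
      Finset.single_le_sum (f := fun l => ∑ k ∈ Finset.range (l + 1), F k l + 1)
        (fun _ _ => Nat.zero_le _) (Finset.mem_range.2 (by omega))
    omega

/-- Every family indexed by a well-order of type `ω₁` is dominated termwise by a strictly
`<*`-increasing family of strictly increasing functions. -/
theorem exists_scale {I : Type*} [LinearOrder I] [WellFoundedLT I]
    (hI : ∀ i : I, (Iio i).Countable) (G : I → ℕ → ℕ) :
    ∃ F : I → ℕ → ℕ, (∀ i, StrictMono (F i)) ∧ (∀ i, G i ≤ᶠ[atTop] F i) ∧
      ∀ i j, i < j → ∀ᶠ n in atTop, F i n < F j n := by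
  have step : ∀ (i : I) (f : Iio i → ℕ → ℕ), ∃ h : ℕ → ℕ, StrictMono h ∧
      (G i ≤ᶠ[atTop] h) ∧ ∀ j, ∀ᶠ n in atTop, f j n < h n := by
    intro i f
    have := (hI i).to_subtype
    obtain ⟨h, hm, hh⟩ := exists_strictMono_dominating fun o : Option (Iio i) => o.elim (G i) f
    exact ⟨h, hm, (hh none).mono fun n hn => le_of_lt hn, fun j => hh (some j)⟩
  choose H Hm HG HF using step
  let F : I → ℕ → ℕ := wellFounded_lt.fix fun i f => H i fun j => f j j.2
  have hF : ∀ i, F i = H i fun j => F j := fun i => wellFounded_lt.fix_eq _ i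
  refine ⟨F, fun i => hF i ▸ Hm i _, fun i => hF i ▸ HG i _, fun i j hij => ?_⟩
  have := HF j (fun k => F k) ⟨i, hij⟩
  rwa [← hF j] at this

/-- If `f` grows fast, its range misses an interval of the partition given by `m`. -/
theorem exists_interval_disjoint_range {m f : ℕ → ℕ} (hm : Monotone m) (hf : StrictMono f) {n : ℕ}
    (hn : m (2 * n + 1) ≤ f n) :
    ∃ j, n ≤ j ∧ j ≤ 2 * n ∧ ∀ i, m j ≤ i → i < m (j + 1) → i ∉ range f := by
  by_contra! hcon
  have : ∀ j ∈ Finset.Icc n (2 * n), ∃ l, m j ≤ f l ∧ f l < m (j + 1) := by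
    intro j hj
    obtain ⟨h1, h2⟩ := Finset.mem_Icc.1 hj
    obtain ⟨_, h3, h4, l, rfl⟩ := hcon j h1 h2
    exact ⟨l, h3, h4⟩
  choose! l hl1 hl2 using this
  -- Pigeonhole: only `f 0, …, f (n - 1)` can lie below `m (2 * n + 1)`, too few to meet all `n + 1`
  -- disjoint intervals.
  have hmaps : ∀ j ∈ Finset.Icc n (2 * n), l j ∈ Finset.range n := by
    intro j hj
    refine Finset.mem_range.2 (hf.lt_iff_lt.1 ((hl2 j hj).trans_le (le_trans (hm ?_) hn)))
    have := (Finset.mem_Icc.1 hj).2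
    omega
  obtain ⟨a, ha, b, hb, hab, he⟩ := Finset.exists_ne_map_eq_of_card_lt_of_maps_to
    (by simp only [Finset.card_range, Nat.card_Icc]; omega) hmaps
  rcases hab.lt_or_gt with h | h
  · have h1 := hl2 a ha
    have h2 := hl1 b hb
    have h3 := hm (show a + 1 ≤ b from h)
    rw [he] at h1
    omega
  · have h1 := hl2 b hb
    have h2 := hl1 a ha
    have h3 := hm (show b + 1 ≤ a from h)
    rw [he] at h2
    omega

end Scales

/-! ### Neighbourhoods of the finite sets in the Cantor space -/

section Cantor

/-- The characteristic function of the range of `f`. -/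
noncomputable def rangeIndicator (f : ℕ → ℕ) : ℕ → Bool := by
  classical exact fun n => decide (n ∈ range f)

theorem rangeIndicator_eq_false {f : ℕ → ℕ} {n : ℕ} : rangeIndicator f n = false ↔ n ∉ range f := by
  simp [rangeIndicator]

theorem rangeIndicator_injOn : InjOn rangeIndicator {f | StrictMono f} := by
  intro f hf g hg h
  refine (StrictMono.range_inj hf hg).1 (ext fun n => ?_)
  have := congrFun h n
  rw [← not_iff_not, ← rangeIndicator_eq_false, ← rangeIndicator_eq_false, this]

/-- The points of the Cantor space with finite support. -/
def finSupp : Set (ℕ → Bool) := {x | ∃ M, ∀ i ≥ M, x i = false}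

theorem finite_support_below (M : ℕ) : {x : ℕ → Bool | ∀ i ≥ M, x i = false}.Finite := by
  refine Finite.of_injOn (f := fun x (i : Fin M) => x i) (t := univ) (fun _ _ => mem_univ _)
    ?_ finite_univ
  intro x hx y hy h
  funext i
  by_cases hi : i < M
  · exact congrFun h ⟨i, hi⟩
  · rw [hx i (not_lt.1 hi), hy i (not_lt.1 hi)]

theorem countable_finSupp : finSupp.Countable := by
  have : finSupp = ⋃ M, {x : ℕ → Bool | ∀ i ≥ M, x i = false} := by
    ext x
    simp [finSupp]
  rw [this]
  exact countable_iUnion fun M => (finite_support_below M).countable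

/-- Compactness is used twice: the finitely many points supported below `M` lie in one `W k`, and
the closed sets of points vanishing on `[M, M')` decrease to them as `M'` grows. -/
theorem exists_gap {W : ℕ → Set (ℕ → Bool)} (hW : ∀ k, IsOpen (W k)) (hmono : Monotone W)
    (hcov : finSupp ⊆ ⋃ k, W k) (M : ℕ) :
    ∃ M' > M, ∃ k, ∀ x : ℕ → Bool, (∀ i, M ≤ i → i < M' → x i = false) → x ∈ W k := by
  obtain ⟨k, hk⟩ := (finite_support_below M).isCompact.elim_directed_cover W hW
    (fun x hx => hcov ⟨M, hx⟩) hmono.directed_le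
  have hclosed : ∀ M', IsClosed {x : ℕ → Bool | ∀ i, M ≤ i → i < M' → x i = false} := by
    intro M'
    simp only [ofPred_forall]
    exact isClosed_iInter fun i => isClosed_iInter fun _ => isClosed_iInter fun _ =>
      isClosed_singleton.preimage (continuous_apply i)
  have hanti : Antitone fun M' => {x : ℕ → Bool | ∀ i, M ≤ i → i < M' → x i = false} :=
    fun a b hab x hx i h1 h2 => hx i h1 (h2.trans_le hab)
  obtain ⟨M', hM'⟩ := exists_subset_nhds_of_compactSpace (U := W k) hanti.directed_ge hclosed
    fun x hx => (hW k).mem_nhds (hk fun i hi => mem_iInter.1 hx (i + 1) i hi (Nat.lt_succ_self i))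
  exact ⟨max M' (M + 1), by simp, k, fun x hx => hM' (hanti (le_max_left _ _) hx)⟩

theorem exists_interval_partition {W : ℕ → ℕ → Set (ℕ → Bool)} (hW : ∀ n k, IsOpen (W n k))
    (hmono : ∀ n, Monotone (W n)) (hcov : ∀ n, finSupp ⊆ ⋃ k, W n k) :
    ∃ m k : ℕ → ℕ, Monotone m ∧ ∀ j, ∀ x : ℕ → Bool,
      (∀ i, m j ≤ i → i < m (j + 1) → x i = false) → x ∈ W j (k j) := by
  choose e he k hk using fun n => exists_gap (hW n) (hmono n) (hcov n)
  let m : ℕ → ℕ := fun n => Nat.rec 0 (fun j a => e j a) n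
  exact ⟨m, fun j => k j (m j), monotone_nat_of_le_succ fun n => (he n (m n)).le,
    fun j x hx => hk j (m j) x hx⟩

end Cantor

/-! ### The set coded by an unbounded scale -/

section ScaleSets

variable {I : Type*} [LinearOrder I] {F : I → ℕ → ℕ}

/-- The set of reals obtained from a family in `ℕ → ℕ` by coding its members, as well as the
finite subsets of `ℕ`, through a map from the Cantor space. -/
def scaleSet (φ : (ℕ → Bool) → ℝ) (F : I → ℕ → ℕ) : Set ℝ :=
  φ '' (finSupp ∪ range fun i => rangeIndicator (F i))

variable {φ : (ℕ → Bool) → ℝ}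

theorem not_countable_scaleSet (hφ : Function.Injective φ) (hI : ¬ Countable I)
    (hm : ∀ i, StrictMono (F i)) (hlt : ∀ i j, i < j → ∀ᶠ n in atTop, F i n < F j n) :
    ¬ (scaleSet φ F).Countable := by
  intro h
  have h1 := countable_of_injective_of_countable_image hφ.injOn h
  have hinj : Function.Injective fun i => rangeIndicator (F i) := by
    have key : ∀ i j, i < j → rangeIndicator (F i) ≠ rangeIndicator (F j) := by
      intro i j hij he
      obtain ⟨n, hn⟩ := (hlt i j hij).exists
      rw [rangeIndicator_injOn (hm i) (hm j) he] at hn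
      exact lt_irrefl _ hn
    intro i j he
    by_contra hne
    rcases lt_or_gt_of_ne hne with h | h
    · exact key i j h he
    · exact key j i h he.symm
  have h2 := h1.mono subset_union_right
  have := h2.to_subtype
  exact hI (Equiv.ofInjective _ hinj).injective.countable

/-- One member exceeding `g` infinitely often fixes places `A n` that serve all later members at
once, since these eventually dominate it. -/
theorem frequently_lt_of_unbounded (hunb : ∀ g : ℕ → ℕ, ∃ i, ¬ F i ≤ᶠ[atTop] g)
    (hlt : ∀ i j, i < j → ∀ᶠ n in atTop, F i n < F j n) (g : ℕ → ℕ) :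
    ∃ i₀, ∃ A : ℕ → ℕ, (∀ n, n ≤ A n) ∧ ∀ i ≥ i₀, ∀ᶠ n in atTop, g (A n) ≤ F i (A n) := by
  obtain ⟨i₀, hi₀⟩ := hunb g
  have : ∃ᶠ n in atTop, g n < F i₀ n := by
    refine fun h => hi₀ (h.mono fun n hn => not_lt.1 hn)
  choose A hA hgA using frequently_atTop.1 this
  refine ⟨i₀, A, hA, fun i hi => ?_⟩
  have hle : ∀ᶠ n in atTop, F i₀ n ≤ F i n := by
    rcases hi.eq_or_lt with rfl | h
    · exact Eventually.of_forall fun _ => le_rfl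
    · exact (hlt _ _ h).mono fun _ => le_of_lt
  filter_upwards [(tendsto_atTop_mono hA tendsto_id).eventually hle] with n hn
  exact (hgA n).le.trans hn

theorem s1_scaleSet (hφ : Continuous φ) (hI : ∀ i : I, (Iio i).Countable)
    (hm : ∀ i, StrictMono (F i)) (hlt : ∀ i j, i < j → ∀ᶠ n in atTop, F i n < F j n)
    (hunb : ∀ g : ℕ → ℕ, ∃ i, ¬ F i ≤ᶠ[atTop] g) :
    S1 (openCovers (scaleSet φ F)) (openCovers (scaleSet φ F)) := by
  refine s1_of_concentrated (D := Subtype.val ⁻¹' (φ '' finSupp))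
    ((countable_finSupp.image φ).preimage Subtype.val_injective) fun U hU hDU => ?_
  obtain ⟨O, hO, rfl⟩ := isOpen_induced_iff.1 hU
  have hcov : finSupp ⊆ φ ⁻¹' O := fun x hx =>
    hDU (a := ⟨φ x, mem_image_of_mem _ (Or.inl hx)⟩) ⟨x, hx, rfl⟩
  obtain ⟨m, -, hmm, hmW⟩ := exists_interval_partition (W := fun _ _ => φ ⁻¹' O)
    (fun _ _ => hO.preimage hφ) (fun _ => monotone_const) fun _ x hx => mem_iUnion.2 ⟨0, hcov hx⟩
  obtain ⟨i₀, A, -, hA⟩ := frequently_lt_of_unbounded hunb hlt fun n => m (2 * n + 1)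
  refine (((hI i₀).image fun i => φ (rangeIndicator (F i))).preimage
    Subtype.val_injective).mono ?_
  rintro ⟨_, x, hx | ⟨i, rfl⟩, rfl⟩ hxU
  · exact absurd (hcov hx) hxU
  · refine ⟨i, not_le.1 fun hi => hxU ?_, rfl⟩
    obtain ⟨n, hn⟩ := (hA i hi).exists
    obtain ⟨j, -, -, hj⟩ := exists_interval_disjoint_range hmm (hm i) hn
    exact hmW j _ fun l h1 h2 => rangeIndicator_eq_false.2 (hj l h1 h2)

theorem ufin_scaleSet (hφ : Continuous φ) (hI : ∀ i : I, (Iio i).Countable)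
    (hm : ∀ i, StrictMono (F i)) (hlt : ∀ i j, i < j → ∀ᶠ n in atTop, F i n < F j n)
    (hunb : ∀ g : ℕ → ℕ, ∃ i, ¬ F i ≤ᶠ[atTop] g) :
    Ufin (openCovers (scaleSet φ F)) (gammaCovers (scaleSet φ F)) := by
  refine ufin_of_countable_covers fun U hU hcov => ?_
  choose O hO hOU using fun n k => isOpen_induced_iff.1 (hU n k)
  -- `W j` refines the covers `0, …, j` together, so a gap found at any `j ≥ n` still serves the
  -- `n`-th cover.
  let W : ℕ → ℕ → Set (ℕ → Bool) := fun n k => ⋂ i ∈ Iic n, ⋃ l ∈ Iic k, φ ⁻¹' O i l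
  have hmemO : ∀ n k (x : scaleSet φ F), x ∈ U n k ↔ (x : ℝ) ∈ O n k := by
    intro n k x
    rw [← hOU]
    rfl
  have hmono : ∀ n, Monotone (W n) := fun n a b hab =>
    iInter₂_mono fun i _ => biUnion_subset_biUnion_left (Iic_subset_Iic.2 hab)
  have hWcov : ∀ n, finSupp ⊆ ⋃ k, W n k := by
    intro n x hx
    choose K hK using fun i => hcov i ⟨φ x, mem_image_of_mem _ (Or.inl hx)⟩
    refine mem_iUnion.2 ⟨(Finset.range (n + 1)).sup K, mem_iInter₂.2 fun i hi =>
      mem_iUnion₂.2 ⟨K i, ?_, (hmemO _ _ _).1 (hK i)⟩⟩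
    exact Finset.le_sup (f := K) (Finset.mem_range.2 (Nat.lt_succ_of_le hi))
  obtain ⟨m, k, hmm, hmW⟩ := exists_interval_partition
    (fun n k => (finite_Iic n).isOpen_biInter fun i _ =>
      isOpen_biUnion fun l _ => (hO i l).preimage hφ) hmono hWcov
  obtain ⟨i₀, A, hnA, hA⟩ := frequently_lt_of_unbounded hunb hlt fun n => m (2 * n + 1)
  have hC : (Subtype.val ⁻¹' (φ '' (finSupp ∪ (fun i => rangeIndicator (F i)) '' Iio i₀)) :
      Set (scaleSet φ F)).Countable :=
    ((countable_finSupp.union ((hI i₀).image _)).image φ).preimage Subtype.val_injective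
  have := hC.to_subtype
  choose G hG using hcov
  obtain ⟨h₂, -, hh₂⟩ := exists_strictMono_dominating
    fun (x : (Subtype.val ⁻¹' (φ '' (finSupp ∪ (fun i => rangeIndicator (F i)) '' Iio i₀)) :
      Set (scaleSet φ F))) n => G n x
  -- `h₂` handles the countably many points coded before `i₀` or by finite sets. For the others the
  -- gap has index `j ≤ 2 * A n`, whence the supremum of `k`.
  refine ⟨fun n => max (h₂ n) ((Finset.range (2 * A n + 1)).sup k), fun x => ?_⟩
  by_cases hx : x ∈ (Subtype.val ⁻¹' (φ '' (finSupp ∪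
      (fun i => rangeIndicator (F i)) '' Iio i₀)) : Set (scaleSet φ F))
  · filter_upwards [hh₂ ⟨x, hx⟩] with n hn
    exact ⟨G n x, hn.le.trans (le_max_left _ _), hG n x⟩
  · obtain ⟨_, y, hy | ⟨i, rfl⟩, rfl⟩ := x
    · exact absurd ⟨y, Or.inl hy, rfl⟩ hx
    have hi : i₀ ≤ i := not_lt.1 fun h => hx ⟨_, Or.inr ⟨i, h, rfl⟩, rfl⟩
    filter_upwards [hA i hi] with n hn
    obtain ⟨j, hj1, hj2, hj⟩ := exists_interval_disjoint_range hmm (hm i) hn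
    have hW := hmW j _ fun l h1 h2 => rangeIndicator_eq_false.2 (hj l h1 h2)
    obtain ⟨l, hl, hxl⟩ := mem_iUnion₂.1 (mem_iInter₂.1 hW n ((hnA n).trans hj1))
    refine ⟨l, le_trans hl (le_trans ?_ (le_max_right _ _)), (hmemO _ _ _).2 hxl⟩
    exact Finset.le_sup (f := k) (Finset.mem_range.2 (by omega))

end ScaleSets

/-! ### The dichotomy and the theorem -/

/-- If some family of `ℵ₁` functions is unbounded, there is an uncountable Gerlits–Nagy set. -/
theorem exists_uncountable_gerlitsNagy_of_unbounded {I : Type*} [LinearOrder I] [WellFoundedLT I]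
    (hI : ∀ i : I, (Iio i).Countable) (hIu : ¬ Countable I) {G : I → ℕ → ℕ}
    (hG : ∀ g : ℕ → ℕ, ∃ i, ¬ G i ≤ᶠ[atTop] g) :
    ∃ X : Set ℝ, GerlitsNagy X ∧ ¬ X.Countable := by
  obtain ⟨F, hm, hGF, hlt⟩ := exists_scale hI G
  have hunb : ∀ g : ℕ → ℕ, ∃ i, ¬ F i ≤ᶠ[atTop] g := fun g =>
    let ⟨i, hi⟩ := hG g
    ⟨i, fun h => hi ((hGF i).trans h)⟩
  let φ : (ℕ → Bool) → ℝ := fun x => cantorSetHomeomorphNatToBool.symm x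
  have hφ : Continuous φ := continuous_subtype_val.comp (Homeomorph.continuous _)
  have hinj : Function.Injective φ := Subtype.val_injective.comp (Homeomorph.injective _)
  exact ⟨scaleSet φ F, ⟨s1_scaleSet hφ hI hm hlt hunb, ufin_scaleSet hφ hI hm hlt hunb⟩,
    not_countable_scaleSet hinj hIu hm hlt⟩

theorem exists_uncountable_gerlitsNagy {X : Set ℝ} (hX : StrongMeasureZero X)
    (hXu : ¬ X.Countable) : ∃ Y : Set ℝ, GerlitsNagy Y ∧ ¬ Y.Countable := by
  -- `I` is a copy of `ω₁`: uncountable, with countable initial segments.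
  let I : Type := (ℵ₁ : Cardinal.{0}).ord.ToType
  have hIcard : #I = ℵ₁ := by simp [I]
  have hIu : ¬ Countable I := by
    rw [← mk_le_aleph0_iff, hIcard, not_le]
    exact aleph0_lt_aleph_one
  have hI : ∀ i : I, (Iio i).Countable := by
    intro i
    rw [← le_aleph0_iff_set_countable, ← Order.lt_succ_iff, succ_aleph0]
    have hlt : #(Iio i) < #I := mk_Iio_lt i (by rw [hIcard]; exact (Ordinal.type_toType _).symm)
    rwa [hIcard] at hlt
  by_cases hb : ∀ G : I → ℕ → ℕ, ∃ g, ∀ i, G i ≤ᶠ[atTop] g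
  · have hle : #I ≤ #X := by
      rw [hIcard, ← succ_aleph0, Order.succ_le_iff, ← not_le, le_aleph0_iff_set_countable]
      exact hXu
    obtain ⟨e⟩ := hle
    have hinj : Function.Injective fun i => (e i : ℝ) := Subtype.val_injective.comp e.injective
    refine ⟨range fun i => (e i : ℝ), (hX.mono ?_).gerlitsNagy_of_bounded fun G => ?_, fun h => ?_⟩
    · rintro _ ⟨i, rfl⟩
      exact (e i).2
    · obtain ⟨g, hg⟩ := hb fun i => G ⟨e i, i, rfl⟩
      refine ⟨g, ?_⟩
      rintro ⟨_, i, rfl⟩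
      exact hg i
    · have := h.to_subtype
      exact hIu (Equiv.ofInjective _ hinj).injective.countable
  · push Not at hb
    obtain ⟨G, hG⟩ := hb
    exact exists_uncountable_gerlitsNagy_of_unbounded hI hIu hG

end BorelConj

theorem mainTheorem1 :
    BorelConj.BC BorelConj.GerlitsNagy ↔ BorelConj.BC BorelConj.StrongMeasureZero := by
  constructor
  · intro h X hX
    by_contra hXu
    obtain ⟨Y, hY, hYu⟩ := BorelConj.exists_uncountable_gerlitsNagy hX hXu
    exact hYu (h Y hY)
  · exact fun h X hX => h X (BorelConj.strongMeasureZero_of_s1 hX.1)
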